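/- Let $d\ge 2$ be a fixed integer and let $\delta$ be a fixed real number with $\delta<\frac{d-1}{d+1}$. For each $n$, let $\mathcal H$ be the random $d$-uniform hypergraph on the vertex set $[n]$ in which each of the $\binom nd$ sets of $d$ vertices is a hyperedge independently with probability $p=n^{-d+1+\delta}$. Let $G_p$ be the projected graph of $\mathcal H$: the graph on $[n]$ in which two distinct vertices are adjacent if and only if some hyperedge of $\mathcal H$ contains both. Let $\mathcal H_c$ be the clique hypergraph of $G_p$: the $d$-uniform hypergraph on $[n]$ whose hyperedges are all $d$-element sets of vertices that are pairwise adjacent in $G_p$. Call two hyperedges 2-neighbors if they have at least two vertices in common; the 2-connected components of a hypergraph are the connected components of the graph whose nodes are its hyperedges and whose edges join distinct 2-neighbors. Then, with probability tending to $1$ as $n\to\infty$, every 2-connected component of $\mathcal H_c$ consists of at most $$1+\frac{2^{d+1}}{\frac{d-1}{d+1}-\delta}$$ hyperedges. (This bound does not depend on $n$, so all 2-connected components have size $O(1)$.) -/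

import Mathlib

open MeasureTheory ProbabilityTheory Filter Topology

/-! A hypergraph on the vertex set `V` is represented by its set of hyperedges, a
`Set (Finset V)`. -/

/-- The projected graph of a hypergraph: two distinct vertices are adjacent when some hyperedge
contains both. -/
def projGraph {V : Type*} (H : Set (Finset V)) : SimpleGraph V where
  Adj i j := i ≠ j ∧ ∃ h ∈ H, i ∈ h ∧ j ∈ h
  symm := ⟨fun _ _ hij => ⟨hij.1.symm, hij.2.imp fun _ hh => ⟨hh.1, hh.2.2, hh.2.1⟩⟩⟩
  loopless := ⟨fun _ hii => hii.1 rfl⟩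

/-- The (`d`-uniform) clique hypergraph of a graph: its hyperedges are all `d`-element vertex sets
whose vertices are pairwise adjacent. -/
def cliqueHypergraph {V : Type*} (d : ℕ) (G : SimpleGraph V) : Set (Finset V) :=
  G.cliqueSet d

/-- The graph on the hyperedges of `H` in which two different hyperedges are adjacent when they are
2-neighbors, that is, when they share at least two vertices. -/
def twoNeighborGraph {V : Type*} [DecidableEq V] (H : Set (Finset V)) : SimpleGraph H where
  Adj h h' := h ≠ h' ∧ 2 ≤ (h.1 ∩ h'.1).card
  symm := ⟨fun _ _ hh => ⟨hh.1.symm, by rw [Finset.inter_comm]; exact hh.2⟩⟩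
  loopless := ⟨fun _ hh => hh.1 rfl⟩

/-- `C` is a 2-connected component of the hypergraph `H`: a set of hyperedges of `H` forming a
connected component of the 2-neighbor graph. -/
def IsTwoConnectedComponent {V : Type*} [DecidableEq V] (H C : Set (Finset V)) : Prop :=
  ∃ c : (twoNeighborGraph H).ConnectedComponent, C = Subtype.val '' c.supp

/-- The hyperedge probability `p = n ^ (-d + 1 + δ)`, capped at `1` in order to be a probability
for all parameters. -/
noncomputable def hyperedgeProb (d : ℕ) (δ : ℝ) (n : ℕ) : unitInterval :=
  Set.projIcc 0 1 zero_le_one ((n : ℝ) ^ (-(d : ℝ) + 1 + δ))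

/-- The cap in `hyperedgeProb` is inactive as soon as `δ ≤ d - 1` and `n ≥ 1`. -/
theorem coe_hyperedgeProb (d : ℕ) (δ : ℝ) (hδ : δ ≤ (d : ℝ) - 1) (n : ℕ) (hn : 1 ≤ n) :
    (hyperedgeProb d δ n : ℝ) = (n : ℝ) ^ (-(d : ℝ) + 1 + δ) := by
  have h0 : (0 : ℝ) ≤ (n : ℝ) ^ (-(d : ℝ) + 1 + δ) := by positivity
  have h1 : (n : ℝ) ^ (-(d : ℝ) + 1 + δ) ≤ 1 :=
    Real.rpow_le_one_of_one_le_of_nonpos (by exact_mod_cast hn) (by linarith)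
  unfold hyperedgeProb
  rw [Set.projIcc_of_mem zero_le_one ⟨h0, h1⟩]

/-- The law of the random `d`-uniform hypergraph on `n` vertices: each of the `d`-element sets of
vertices is a hyperedge independently with probability `p`. -/
noncomputable def randomHypergraph (n d : ℕ) (p : unitInterval) :
    Measure (Set (Finset (Fin n))) :=
  setBernoulli {h : Finset (Fin n) | h.card = d} p

/-! ### Edge counts: gluing cliques and counting cliques in sparse graphs. -/

section Deterministic

/-! Write `c = (d - 1) / (d + 1) - δ > 0`. A configuration of `k` hyperedges on `v` vertices has
about `n ^ (v - k (d - 1 - δ))` expected copies, so with high probability every subfamily of bounded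
size spans at least `k (d - 1 - δ)` vertices. The rest is deterministic.

Suppose a component has `N > 2 ^ (d + 1) / c` cliques, and let `W` be the vertex set of a
2-connected subfamily of exactly `N` of them. The potential `(d + 1) |W| - #adjPairs W` is `2 d` for
one clique and does not grow under gluing (`potential_union_clique`). If `F` is a small family of
hyperedges covering the edges in `W`, the spanning condition makes this potential at least `(d + 1)
c |F|` (`card_adjPairs_add_le`). Hence `|F| ≤ 2 d / ((d + 1) c)`. Moreover `|W| ≤ d |F|`, and
sparsity gives `N ≤ d |W|` (`card_cliques_le_of_sparse`). So `N ≤ 2 d ^ 3 / ((d + 1) c) ≤ 2 ^ (d +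
1) / c`, a contradiction. -/

open Classical in
/-- The ordered pairs of adjacent vertices in `U`. -/
noncomputable def adjPairs {V : Type*} (G : SimpleGraph V) (U : Finset V) : Finset (V × V) :=
  (U ×ˢ U).filter fun x => G.Adj x.1 x.2

variable {V : Type*} {G : SimpleGraph V} {H : Set (Finset V)} {d : ℕ}

theorem mem_adjPairs {U : Finset V} {x : V × V} :
    x ∈ adjPairs G U ↔ x.1 ∈ U ∧ x.2 ∈ U ∧ G.Adj x.1 x.2 := by
  simp [adjPairs, and_assoc]

theorem adjPairs_subset_offDiag [DecidableEq V] (U : Finset V) : adjPairs G U ⊆ U.offDiag := by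
  intro x hx
  obtain ⟨h1, h2, h3⟩ := mem_adjPairs.1 hx
  exact Finset.mem_offDiag.2 ⟨h1, h2, h3.ne⟩

theorem cast_card_offDiag [DecidableEq V] (U : Finset V) :
    (U.offDiag.card : ℤ) = U.card * (U.card - 1) := by
  rw [Finset.offDiag_card, Nat.cast_sub (Nat.le_mul_self _)]
  push_cast
  ring

variable [DecidableEq V]

theorem adjPairs_eq_offDiag {U : Finset V} (hU : G.IsClique U) : adjPairs G U = U.offDiag := by
  refine (adjPairs_subset_offDiag U).antisymm fun x hx => ?_
  obtain ⟨h1, h2, h3⟩ := Finset.mem_offDiag.1 hx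
  exact mem_adjPairs.2 ⟨h1, h2, hU h1 h2 h3⟩

theorem card_adjPairs_supermodular (A B : Finset V) :
    (adjPairs G A).card + (adjPairs G B).card ≤
      (adjPairs G (A ∪ B)).card + (adjPairs G (A ∩ B)).card := by
  rw [← Finset.card_union_add_card_inter]
  gcongr
  · intro x hx
    simp only [Finset.mem_union, mem_adjPairs] at hx ⊢
    tauto
  · intro x hx
    simp only [Finset.mem_inter, mem_adjPairs] at hx ⊢
    tauto

/-- Gluing a `d`-clique to `W` along at least two vertices does not increase
`(d + 1) |W| - #adjPairs W`. -/
theorem potential_union_clique {W h : Finset V} (hh : G.IsNClique d h)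
    (hs : 2 ≤ (W ∩ h).card)
    (hW : (d + 1) * W.card ≤ 2 * d + (adjPairs G W).card) :
    (d + 1) * (W ∪ h).card ≤ 2 * d + (adjPairs G (W ∪ h)).card := by
  have h1 := card_adjPairs_supermodular (G := G) W h
  have h2 : ((adjPairs G h).card : ℤ) = d * (d - 1) := by
    rw [adjPairs_eq_offDiag hh.isClique, cast_card_offDiag, hh.card_eq]
  have h3 : ((adjPairs G (W ∩ h)).card : ℤ) ≤ (W ∩ h).card * ((W ∩ h).card - 1) := by
    rw [← cast_card_offDiag]
    exact_mod_cast Finset.card_le_card (adjPairs_subset_offDiag _)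
  have h4 := Finset.card_union_add_card_inter W h
  have h5 : (W ∩ h).card ≤ d := hh.card_eq ▸ Finset.card_le_card Finset.inter_subset_right
  rw [hh.card_eq] at h4
  zify at *
  -- With `s = |W ∩ h|`, the potential changes by at most `(d + 1) (d - s) - (d (d - 1) - s (s - 1))
  -- = -(d - s) (s - 2)`.
  have h6 : 0 ≤ ((d : ℤ) - (W ∩ h).card) * ((W ∩ h).card - 2) :=
    mul_nonneg (by linarith) (by linarith)
  nlinarith

/-- Since `adjPairs` counts ordered pairs, its size is the degree sum, so some vertex has degree at
most `d` in `W`. A `d`-clique through it is given by `d - 1` of its neighbours, which leaves at most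
`d` choices. Delete the vertex and induct; sparsity is hereditary. -/
theorem card_cliques_le_of_sparse (hd : 1 ≤ d) (W : Finset V)
    (hW : ∀ U ⊆ W, U.Nonempty → (adjPairs G U).card < (d + 1) * U.card)
    (S : Finset (Finset V)) (hS : ∀ h ∈ S, h ⊆ W ∧ G.IsNClique d h) :
    S.card ≤ d * W.card := by
  classical
  induction W using Finset.strongInduction generalizing S with
  | H W ih =>
    rcases W.eq_empty_or_nonempty with rfl | hne
    · have : S = ∅ := by
        refine Finset.eq_empty_of_forall_notMem fun h hh => ?_
        obtain ⟨h1, h2⟩ := hS h hh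
        have := h2.card_eq
        rw [Finset.subset_empty.1 h1] at this
        simp at this
        omega
      simp [this]
    · obtain ⟨v, hv, hdeg⟩ : ∃ v ∈ W, (W.filter (G.Adj v)).card < d + 1 := by
        refine Finset.exists_lt_of_sum_lt (f := fun v => (W.filter (G.Adj v)).card) ?_
        have := hW W subset_rfl hne
        rw [adjPairs, Finset.card_filter, Finset.sum_product] at this
        simp only [Finset.card_filter, Finset.sum_const, smul_eq_mul]
        rwa [mul_comm W.card]
      have h1 : (S.filter (v ∉ ·)).card ≤ d * (W.erase v).card := by
        refine ih _ (Finset.erase_ssubset hv)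
          (fun U hU => hW U (hU.trans (Finset.erase_subset _ _))) _ fun h hh => ?_
        obtain ⟨hh, hvh⟩ := Finset.mem_filter.1 hh
        exact ⟨Finset.subset_erase.2 ⟨(hS h hh).1, hvh⟩, (hS h hh).2⟩
      have h2 : (S.filter (v ∈ ·)).card ≤ d := by
        calc (S.filter (v ∈ ·)).card
            ≤ (Finset.powersetCard (d - 1) (W.filter (G.Adj v))).card := by
              refine Finset.card_le_card_of_injOn (fun h => h.erase v) ?_ ?_
              · intro h hh
                obtain ⟨hh, hvh⟩ := Finset.mem_filter.1 hh
                obtain ⟨hhW, hc⟩ := hS h hh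
                refine Finset.mem_powersetCard.2 ⟨fun x hx => ?_, ?_⟩
                · obtain ⟨hxv, hx⟩ := Finset.mem_erase.1 hx
                  exact Finset.mem_filter.2 ⟨hhW hx, hc.isClique hvh hx hxv.symm⟩
                · rw [Finset.card_erase_of_mem hvh, hc.card_eq]
              · intro h hh h' hh' he
                have e1 := (Finset.mem_filter.1 hh).2
                have e2 := (Finset.mem_filter.1 hh').2
                rw [← Finset.insert_erase e1, ← Finset.insert_erase e2]
                exact congrArg (insert v) he
          _ = (W.filter (G.Adj v)).card.choose (d - 1) := Finset.card_powersetCard _ _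
          _ ≤ d.choose (d - 1) := Nat.choose_le_choose _ (by omega)
          _ = d := by
              obtain ⟨k, rfl⟩ := Nat.exists_eq_add_of_le' hd
              simp
      have h3 := Finset.card_filter_add_card_filter_not (s := S) (v ∈ ·)
      have h4 := Finset.card_erase_add_one hv
      rw [← h4, mul_add, mul_one]
      omega

/-! ### Sparsity of the projected graph from the spanning condition. -/

/-- A small family of hyperedges covering all edges of the projected graph inside `U`. -/
theorem exists_cover (U : Finset V) :
    ∃ F : Finset (Finset V), (F : Set (Finset V)) ⊆ H ∧ F.card ≤ U.card ^ 2 ∧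
      (∀ e ∈ F, 2 ≤ (e ∩ U).card) ∧
      ∀ x ∈ adjPairs (projGraph H) U, ∃ e ∈ F, x.1 ∈ e ∧ x.2 ∈ e := by
  have key : ∀ x : V × V, ∃ e, x ∈ adjPairs (projGraph H) U → e ∈ H ∧ x.1 ∈ e ∧ x.2 ∈ e := by
    intro x
    by_cases hx : x ∈ adjPairs (projGraph H) U
    · obtain ⟨-, e, he⟩ := (mem_adjPairs.1 hx).2.2
      exact ⟨e, fun _ => he⟩
    · exact ⟨∅, fun h => absurd h hx⟩
  choose g hg using key
  refine ⟨(adjPairs (projGraph H) U).image g, ?_, ?_, ?_, ?_⟩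
  · intro e he
    obtain ⟨x, hx, rfl⟩ := Finset.mem_image.1 (Finset.mem_coe.1 he)
    exact (hg x hx).1
  · refine Finset.card_image_le.trans ?_
    rw [sq, ← Finset.card_product]
    refine Finset.card_le_card fun x hx => ?_
    obtain ⟨h1, h2, -⟩ := mem_adjPairs.1 hx
    exact Finset.mem_product.2 ⟨h1, h2⟩
  · intro e he
    obtain ⟨x, hx, rfl⟩ := Finset.mem_image.1 he
    obtain ⟨h1, h2, h3⟩ := mem_adjPairs.1 hx
    rw [← Finset.card_pair h3.ne]
    refine Finset.card_le_card fun y hy => ?_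
    rcases Finset.mem_insert.1 hy with rfl | hy
    · exact Finset.mem_inter.2 ⟨(hg x hx).2.1, h1⟩
    · rw [Finset.mem_singleton.1 hy]
      exact Finset.mem_inter.2 ⟨(hg x hx).2.2, h2⟩
  · intro x hx
    exact ⟨g x, Finset.mem_image_of_mem g hx, (hg x hx).2⟩

/-- If `F` spans at least `|F| (d - 1 - δ)` vertices and covers the edges in `U`, then `U` is
sparse. -/
theorem card_adjPairs_add_le {δ : ℝ} {U : Finset V} {F : Finset (Finset V)}
    (hF : ∀ e ∈ F, e.card = d) (hF2 : ∀ e ∈ F, 2 ≤ (e ∩ U).card)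
    (hcov : ∀ x ∈ adjPairs G U, ∃ e ∈ F, x.1 ∈ e ∧ x.2 ∈ e)
    (hspan : F.card * ((d : ℝ) - 1 - δ) ≤ (F.biUnion id).card) :
    ((adjPairs G U).card : ℝ) + F.card * ((d - 1) - (d + 1) * δ) ≤ (d + 1) * U.card := by
  have h1 : ((adjPairs G U).card : ℝ) ≤ ∑ e ∈ F, ((e ∩ U).card : ℝ) * ((e ∩ U).card - 1) := by
    have : adjPairs G U ⊆ F.biUnion fun e => (e ∩ U).offDiag := by
      intro x hx
      obtain ⟨e, he, hx1, hx2⟩ := hcov x hx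
      obtain ⟨h1, h2, h3⟩ := mem_adjPairs.1 hx
      exact Finset.mem_biUnion.2 ⟨e, he, Finset.mem_offDiag.2
        ⟨Finset.mem_inter.2 ⟨hx1, h1⟩, Finset.mem_inter.2 ⟨hx2, h2⟩, h3.ne⟩⟩
    have := (Finset.card_le_card this).trans Finset.card_biUnion_le
    zify at this
    simp only [cast_card_offDiag] at this
    exact_mod_cast this
  have h2 : ((F.biUnion id).card : ℝ) ≤ U.card + ∑ e ∈ F, ((d : ℝ) - (e ∩ U).card) := by
    have h : F.biUnion id ⊆ U ∪ F.biUnion fun e => e \ U := by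
      intro x hx
      obtain ⟨e, he, hxe⟩ := Finset.mem_biUnion.1 hx
      by_cases hxU : x ∈ U
      · exact Finset.mem_union_left _ hxU
      · exact Finset.mem_union_right _
          (Finset.mem_biUnion.2 ⟨e, he, Finset.mem_sdiff.2 ⟨hxe, hxU⟩⟩)
    have h' : (F.biUnion id).card ≤ U.card + ∑ e ∈ F, (e \ U).card :=
      (Finset.card_le_card h).trans ((Finset.card_union_le _ _).trans
        (Nat.add_le_add_left Finset.card_biUnion_le _))
    have h'' : ∑ e ∈ F, ((e \ U).card : ℝ) = ∑ e ∈ F, ((d : ℝ) - (e ∩ U).card) := by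
      refine Finset.sum_congr rfl fun e he => ?_
      rw [eq_sub_iff_add_eq]
      exact_mod_cast (Finset.card_sdiff_add_card_inter e U).trans (hF e he)
    rw [← h'']
    exact_mod_cast h'
  -- For `t = |e ∩ U|` the gap between the two summands is `(d - t) (t - 2)`, nonnegative as `2 ≤ t
  -- ≤ d`.
  have h3 : ∑ e ∈ F, ((e ∩ U).card : ℝ) * ((e ∩ U).card - 1) ≤
      ∑ e ∈ F, (((d : ℝ) + 1) * ((e ∩ U).card - 1 - δ) - ((d - 1) - (d + 1) * δ)) := by
    refine Finset.sum_le_sum fun e he => ?_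
    have a1 : (2 : ℝ) ≤ (e ∩ U).card := by exact_mod_cast hF2 e he
    have a2 : ((e ∩ U).card : ℝ) ≤ d := by
      exact_mod_cast hF e he ▸ Finset.card_le_card Finset.inter_subset_left
    nlinarith [mul_nonneg (sub_nonneg.2 a1) (sub_nonneg.2 a2)]
  -- Each hyperedge adds at most `d - t` vertices outside `U`, so the spanning condition amounts to
  -- `∑ (t - 1 - δ) ≤ |U|`.
  have h4 : ((d : ℝ) + 1) * (F.card * ((d : ℝ) - 1 - δ)) ≤
      (d + 1) * (U.card + ∑ e ∈ F, ((d : ℝ) - (e ∩ U).card)) :=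
    mul_le_mul_of_nonneg_left (hspan.trans h2) (by positivity)
  have h5 : ((d : ℝ) + 1) * (F.card * ((d : ℝ) - 1 - δ)) -
      (d + 1) * ∑ e ∈ F, ((d : ℝ) - (e ∩ U).card) =
      ∑ e ∈ F, ((d : ℝ) + 1) * ((e ∩ U).card - 1 - δ) := by
    rw [Finset.mul_sum, ← nsmul_eq_mul (F.card), ← Finset.sum_const, Finset.mul_sum,
      ← Finset.sum_sub_distrib]
    exact Finset.sum_congr rfl fun e _ => by ring
  rw [Finset.sum_sub_distrib, Finset.sum_const, nsmul_eq_mul] at h3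
  linarith

/-! ### Size of a 2-connected component. -/

/-- A 2-connected component contains 2-connected subfamilies of every smaller size. -/
theorem exists_connected_subfamily {C : Set (Finset V)}
    (hC : IsTwoConnectedComponent (cliqueHypergraph d G) C) (j : ℕ) (hj : j + 1 ≤ C.ncard) :
    ∃ S : Finset (Finset V), S.card = j + 1 ∧ (S : Set (Finset V)) ⊆ C ∧
      (∀ h ∈ S, G.IsNClique d h) ∧
      (d + 1) * (S.biUnion id).card ≤ 2 * d + (adjPairs G (S.biUnion id)).card := by
  obtain ⟨c, rfl⟩ := hC
  have hclique : ∀ h : cliqueHypergraph d G, G.IsNClique d h.1 := fun h => h.2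
  induction j with
  | zero =>
    obtain ⟨v, hv⟩ := c.nonempty_supp
    refine ⟨{v.1}, by simp, by simpa using hv, by simpa using hclique v, ?_⟩
    rw [Finset.singleton_biUnion, id, adjPairs_eq_offDiag (hclique v).isClique]
    zify
    rw [cast_card_offDiag, (hclique v).card_eq]
    linarith
  | succ j ih =>
    obtain ⟨S, hcard, hSC, hSc, hS⟩ := ih (by omega)
    obtain ⟨w, hw, hwS⟩ : ∃ w ∈ Subtype.val '' c.supp, w ∉ (S : Set (Finset V)) := by
      by_contra! hcon
      have := Set.ncard_le_ncard hcon S.finite_toSet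
      rw [Set.ncard_coe_finset] at this
      omega
    obtain ⟨w, hw, rfl⟩ := hw
    obtain ⟨u, hu⟩ := Finset.card_pos.1 (by omega : 0 < S.card)
    obtain ⟨u, huc, rfl⟩ := hSC hu
    obtain ⟨p⟩ : (twoNeighborGraph (cliqueHypergraph d G)).Reachable u w :=
      SimpleGraph.ConnectedComponent.exact (huc.trans hw.symm)
    -- A walk from inside `S` to a hyperedge of the component outside `S` must leave `S`; the
    -- hyperedge it enters is the one to add.
    obtain ⟨e, -, he1, he2⟩ := p.exists_boundary_dart {x | x.1 ∈ S} hu hwS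
    have he1 : e.fst.1 ∈ S := he1
    have he2 : e.snd.1 ∉ S := he2
    have hfst : e.fst ∈ c.supp := by
      obtain ⟨y, hy, hye⟩ := hSC he1
      rwa [← Subtype.ext hye]
    have hsnd : e.snd ∈ c.supp := (c.mem_supp_congr_adj e.adj).1 hfst
    refine ⟨insert e.snd.1 S, by rw [Finset.card_insert_of_notMem he2, hcard], ?_, ?_, ?_⟩
    · rw [Finset.coe_insert]
      exact Set.insert_subset ⟨_, hsnd, rfl⟩ hSC
    · intro h hh
      rcases Finset.mem_insert.1 hh with rfl | hh
      · exact hclique _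
      · exact hSc h hh
    · rw [Finset.biUnion_insert, id, Finset.union_comm]
      refine potential_union_clique (hclique _) (e.adj.2.trans (Finset.card_le_card ?_)) hS
      exact Finset.inter_subset_inter_right (Finset.subset_biUnion_of_mem id he1)

theorem cube_le_two_pow_mul (d : ℕ) : d ^ 3 ≤ 2 ^ d * (d + 1) := by
  -- The bound `d ^ 2 ≤ 2 ^ d` fails at `d = 3`.
  rcases lt_or_ge d 4 with h | h
  · interval_cases d <;> norm_num
  · have : d ^ 2 ≤ 2 ^ d := by
      induction d, h using Nat.le_induction with
      | base => norm_num
      | succ n hn ih => rw [pow_succ 2]; nlinarith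
    nlinarith [Nat.one_le_two_pow (n := d)]

/-- If every small subfamily of `H` spans many vertices, then all 2-connected components of the
clique hypergraph are small. -/
theorem ncard_component_le (hd : 2 ≤ d) {δ : ℝ} (hδ : δ < ((d : ℝ) - 1) / ((d : ℝ) + 1))
    {N : ℕ} (hN : 2 ^ (d + 1) / (((d : ℝ) - 1) / ((d : ℝ) + 1) - δ) < N)
    (hH : ∀ e ∈ H, e.card = d)
    (hspan : ∀ F : Finset (Finset V), (F : Set (Finset V)) ⊆ H → F.card ≤ (d * N) ^ 2 →
      F.card * ((d : ℝ) - 1 - δ) ≤ (F.biUnion id).card)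
    {C : Set (Finset V)}
    (hC : IsTwoConnectedComponent (cliqueHypergraph d (projGraph H)) C) :
    C.ncard < N := by
  by_contra! hlt
  set c : ℝ := ((d : ℝ) - 1) / ((d : ℝ) + 1) - δ with hc
  have hc0 : 0 < c := sub_pos.2 hδ
  have hdc : ((d : ℝ) - 1) - (d + 1) * δ = (d + 1) * c := by rw [hc]; field_simp
  have hN0 : 0 < N := by
    have : (0 : ℝ) < N := lt_of_le_of_lt (by positivity) hN
    exact_mod_cast this
  obtain ⟨j, rfl⟩ := Nat.exists_eq_add_of_le' hN0
  obtain ⟨S, hcard, -, hcl, hpot⟩ := exists_connected_subfamily hC j hlt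
  set W := S.biUnion id with hWdef
  have hWcard : W.card ≤ d * (j + 1) := by
    have := Finset.card_biUnion_le_card_mul S id d fun h hh => (hcl h hh).card_eq.le
    rwa [hcard, mul_comm] at this
  have key : ∀ U ⊆ W, ∃ F : Finset (Finset V), (F : Set (Finset V)) ⊆ H ∧
      (∀ x ∈ adjPairs (projGraph H) U, ∃ e ∈ F, x.1 ∈ e ∧ x.2 ∈ e) ∧
      ((adjPairs (projGraph H) U).card : ℝ) + F.card * ((d + 1) * c) ≤ (d + 1) * U.card := by
    intro U hU
    obtain ⟨F, hFH, hFc, hF2, hcov⟩ := exists_cover (H := H) U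
    refine ⟨F, hFH, hcov, ?_⟩
    rw [← hdc]
    refine card_adjPairs_add_le (fun e he => hH e (hFH he)) hF2 hcov (hspan F hFH ?_)
    exact hFc.trans (Nat.pow_le_pow_left ((Finset.card_le_card hU).trans hWcard) 2)
  have hSW : j + 1 ≤ d * W.card := by
    rw [← hcard]
    refine card_cliques_le_of_sparse (G := projGraph H) (by omega) W (fun U hU hne => ?_) S
      fun h hh => ⟨Finset.subset_biUnion_of_mem id hh, hcl h hh⟩
    obtain ⟨F, -, hcov, hF⟩ := key U hU
    -- Without edges `F` may be empty and the gain `|F| (d + 1) c` vanishes; strictness then comes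
    -- from `U` being nonempty.
    rcases (adjPairs (projGraph H) U).eq_empty_or_nonempty with he | ⟨x, hx⟩
    · rw [he, Finset.card_empty]
      exact Nat.mul_pos (by omega) hne.card_pos
    · obtain ⟨e, he, -⟩ := hcov x hx
      have h1 : (0 : ℝ) < F.card := by exact_mod_cast Finset.card_pos.2 ⟨e, he⟩
      have h2 : 0 < (F.card : ℝ) * ((d + 1) * c) := by positivity
      have h3 : ((adjPairs (projGraph H) U).card : ℝ) < (d + 1) * U.card := by linarith
      exact_mod_cast h3
  obtain ⟨F, hFH, hcov, hF⟩ := key W subset_rfl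
  -- As `d ≥ 2`, each vertex of `W` has a neighbour in its clique, so the hyperedges covering the
  -- edges also cover the vertices.
  have hWF : W.card ≤ F.card * d := by
    have hsub : W ⊆ F.biUnion id := by
      intro x hx
      obtain ⟨h, hh, hxh⟩ := Finset.mem_biUnion.1 hx
      obtain ⟨y, hy, hyx⟩ := Finset.exists_mem_ne
        (by rw [(hcl h hh).card_eq]; omega : 1 < h.card) x
      obtain ⟨e, he, hxe, -⟩ := hcov (x, y) (mem_adjPairs.2
        ⟨hx, Finset.mem_biUnion.2 ⟨h, hh, hy⟩, (hcl h hh).isClique hxh hy hyx.symm⟩)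
      exact Finset.mem_biUnion.2 ⟨e, he, hxe⟩
    exact (Finset.card_le_card hsub).trans
      (Finset.card_biUnion_le_card_mul F id d fun e he => (hH e (hFH he)).le)
  have hk : (F.card : ℝ) * ((d + 1) * c) ≤ 2 * d := by
    have : ((d : ℝ) + 1) * W.card ≤ 2 * d + (adjPairs (projGraph H) W).card := by
      exact_mod_cast hpot
    linarith
  have hcube : (d : ℝ) ^ 3 ≤ 2 ^ d * (d + 1) := by exact_mod_cast cube_le_two_pow_mul d
  have hfin : ((j + 1 : ℕ) : ℝ) ≤ d ^ 2 * F.card := by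
    have : j + 1 ≤ d ^ 2 * F.card := by nlinarith
    exact_mod_cast this
  rw [div_lt_iff₀ hc0] at hN
  have h1 : 2 ^ (d + 1) * ((d : ℝ) + 1) < d ^ 2 * F.card * c * (d + 1) :=
    mul_lt_mul_of_pos_right (hN.trans_le (mul_le_mul_of_nonneg_right hfin hc0.le)) (by positivity)
  have h2 : (d : ℝ) ^ 2 * (F.card * ((d + 1) * c)) ≤ d ^ 2 * (2 * d) :=
    mul_le_mul_of_nonneg_left hk (by positivity)
  rw [pow_succ] at h1
  linarith

end Deterministic

/-! ### First moment bound for dense subfamilies. -/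

section Probabilistic

instance isProbabilityMeasure_randomHypergraph (n d : ℕ) (p : unitInterval) :
    IsProbabilityMeasure (randomHypergraph n d p) := by
  unfold randomHypergraph
  infer_instance

/-- The event is a box in the product measure. Only an inequality holds, since elements of `F`
outside `u` are never chosen. -/
theorem setBernoulli_real_superset_le {ι : Type*} (u : Set ι) (p : unitInterval) (F : Finset ι) :
    (setBernoulli u p).real {s | (F : Set ι) ⊆ s} ≤ (p : ℝ) ^ F.card := by
  classical
  have h : (fun q : ι → Prop => {i | q i}) ⁻¹' {s | (F : Set ι) ⊆ s} =
      Set.pi F fun _ => {True} := by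
    ext q
    simp [Set.subset_def, Set.mem_pi]
  have h2 : setBernoulli u p {s | (F : Set ι) ⊆ s} ≤
      ((unitInterval.toNNReal p ^ F.card : NNReal) : ENNReal) := by
    rw [setBernoulli_apply', h, Measure.infinitePi_pi _ (fun _ _ => .of_discrete)]
    rw [ENNReal.coe_pow, ← Finset.prod_const]
    refine Finset.prod_le_prod' fun i _ => ?_
    by_cases hi : i ∈ u <;> simp [hi]
  have h3 := ENNReal.toReal_mono ENNReal.coe_ne_top h2
  simpa [measureReal_def] using h3

/-- The `d`-uniform families containing some small subfamily that spans few vertices. -/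
def denseFamilies (n d K : ℕ) (δ : ℝ) : Set (Set (Finset (Fin n))) :=
  {H | (∀ e ∈ H, e.card = d) ∧ ∃ F : Finset (Finset (Fin n)), (F : Set (Finset (Fin n))) ⊆ H ∧
    F.card ≤ K ∧ ((F.biUnion id).card : ℝ) < F.card * ((d : ℝ) - 1 - δ)}

/-- The pairs (number of hyperedges, number of vertices) of the configurations that
are unlikely to occur. -/
noncomputable def denseShapes (d K : ℕ) (δ : ℝ) : Finset (ℕ × ℕ) :=
  (Finset.range (K + 1) ×ˢ Finset.range (K * d + 1)).filter
    fun x => (x.2 : ℝ) < x.1 * ((d : ℝ) - 1 - δ)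

/-- Union bound over the shape, then the spanned vertex set, then the subfamily of its `d`-subsets.
-/
theorem randomHypergraph_real_denseFamilies_le (n d K : ℕ) (δ : ℝ) (p : unitInterval) :
    (randomHypergraph n d p).real (denseFamilies n d K δ) ≤
      ∑ x ∈ denseShapes d K δ, (n : ℝ) ^ x.2 * (((x.2.choose d).choose x.1) * (p : ℝ) ^ x.1) := by
  classical
  have hsub : denseFamilies n d K δ ⊆ ⋃ x ∈ denseShapes d K δ,
      ⋃ U ∈ Finset.powersetCard x.2 (Finset.univ : Finset (Fin n)),
      ⋃ F ∈ Finset.powersetCard x.1 (Finset.powersetCard d U),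
        {H : Set (Finset (Fin n)) | (F : Set (Finset (Fin n))) ⊆ H} := by
    rintro H ⟨hH, F, hFH, hFK, hF⟩
    simp only [Set.mem_iUnion]
    have hle : (F.biUnion id).card ≤ F.card * d :=
      Finset.card_biUnion_le_card_mul F id d fun e he => (hH e (hFH he)).le
    refine ⟨(F.card, (F.biUnion id).card), ?_, F.biUnion id, ?_, F, ?_, hFH⟩
    · refine Finset.mem_filter.2 ⟨Finset.mem_product.2 ⟨?_, ?_⟩, hF⟩
      · exact Finset.mem_range.2 (by simpa using Nat.lt_succ_of_le hFK)
      · exact Finset.mem_range.2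
          (Nat.lt_succ_of_le (hle.trans (Nat.mul_le_mul_right d hFK)))
    · exact Finset.mem_powersetCard.2 ⟨Finset.subset_univ _, rfl⟩
    · refine Finset.mem_powersetCard.2 ⟨fun e he => Finset.mem_powersetCard.2 ⟨?_, ?_⟩, rfl⟩
      · exact Finset.subset_biUnion_of_mem id he
      · exact hH e (hFH he)
  refine (measureReal_mono hsub (measure_ne_top _ _)).trans ((measureReal_biUnion_finset_le _ _).trans ?_)
  refine Finset.sum_le_sum fun x _ => (measureReal_biUnion_finset_le _ _).trans ?_
  have hU : ∀ U ∈ Finset.powersetCard x.2 (Finset.univ : Finset (Fin n)),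
      (randomHypergraph n d p).real (⋃ F ∈ Finset.powersetCard x.1 (Finset.powersetCard d U),
        {H : Set (Finset (Fin n)) | (F : Set (Finset (Fin n))) ⊆ H}) ≤
      ((x.2.choose d).choose x.1) * (p : ℝ) ^ x.1 := by
    intro U hU
    refine (measureReal_biUnion_finset_le _ _).trans ((Finset.sum_le_card_nsmul _ _
      ((p : ℝ) ^ x.1) fun F hF => ?_).trans_eq ?_)
    · rw [← (Finset.mem_powersetCard.1 hF).2]
      exact setBernoulli_real_superset_le _ p F
    · rw [Finset.card_powersetCard, Finset.card_powersetCard, (Finset.mem_powersetCard.1 hU).2,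
        nsmul_eq_mul]
  refine (Finset.sum_le_card_nsmul _ _ _ hU).trans ?_
  rw [nsmul_eq_mul, Finset.card_powersetCard, Finset.card_univ, Fintype.card_fin]
  refine mul_le_mul_of_nonneg_right ?_ (mul_nonneg (Nat.cast_nonneg _) (pow_nonneg p.2.1 _))
  exact_mod_cast Nat.choose_le_pow n x.2

/-- The set of shapes does not depend on `n`, and each shape contributes a constant times a negative
power of `n`. -/
theorem tendsto_randomHypergraph_real_denseFamilies (d K : ℕ) (δ : ℝ) (hδ : δ ≤ (d : ℝ) - 1) :
    Tendsto (fun n : ℕ =>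
      (randomHypergraph n d (hyperedgeProb d δ n)).real (denseFamilies n d K δ))
      atTop (𝓝 0) := by
  have hlim : Tendsto (fun n : ℕ => ∑ x ∈ denseShapes d K δ, ((x.2.choose d).choose x.1 : ℝ) *
      (n : ℝ) ^ (-(x.1 * ((d : ℝ) - 1 - δ) - x.2))) atTop (𝓝 0) := by
    rw [← Finset.sum_const_zero (s := denseShapes d K δ)]
    refine tendsto_finsetSum _ fun x hx => ?_
    rw [← mul_zero ((x.2.choose d).choose x.1 : ℝ)]
    refine Tendsto.const_mul _ ?_
    exact (tendsto_rpow_neg_atTop (sub_pos.2 (Finset.mem_filter.1 hx).2)).comp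
      tendsto_natCast_atTop_atTop
  refine squeeze_zero' (.of_forall fun _ => measureReal_nonneg) ?_ hlim
  filter_upwards [eventually_ge_atTop 1] with n hn
  refine (randomHypergraph_real_denseFamilies_le n d K δ _).trans_eq
    (Finset.sum_congr rfl fun x _ => ?_)
  have hn0 : (0 : ℝ) < n := by exact_mod_cast hn
  rw [coe_hyperedgeProb d δ hδ n hn, ← Real.rpow_natCast, ← Real.rpow_natCast,
    ← Real.rpow_mul hn0.le, mul_left_comm, ← Real.rpow_add hn0]
  congr 2
  ring

end Probabilistic

/-! ### Conclusion: combining both parts. -/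

theorem mainTheorem4 (d : ℕ) (hd : 2 ≤ d) (δ : ℝ)
    (hδ : δ < ((d : ℝ) - 1) / ((d : ℝ) + 1)) :
    Tendsto
      (fun n : ℕ =>
        (randomHypergraph n d (hyperedgeProb d δ n)).real
          {H : Set (Finset (Fin n)) |
            ∀ C : Set (Finset (Fin n)),
              IsTwoConnectedComponent (cliqueHypergraph d (projGraph H)) C →
                (C.ncard : ℝ) ≤
                  1 + 2 ^ (d + 1) / (((d : ℝ) - 1) / ((d : ℝ) + 1) - δ)})
      atTop (𝓝 1) := by
  have hd1 : (0 : ℝ) ≤ (d : ℝ) - 1 := by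
    have : (2 : ℝ) ≤ d := by exact_mod_cast hd
    linarith
  have hδ' : δ ≤ (d : ℝ) - 1 :=
    hδ.le.trans (div_le_self hd1 (by linarith [Nat.cast_nonneg (α := ℝ) d]))
  set B : ℝ := 2 ^ (d + 1) / (((d : ℝ) - 1) / ((d : ℝ) + 1) - δ) with hB
  have hB0 : 0 ≤ B := div_nonneg (by positivity) (sub_pos.2 hδ).le
  -- Here `N = ⌊B⌋ + 1` is the least natural number above `B`. Then `N` cliques span at most `d N`
  -- vertices, and their edges need at most `(d N) ^ 2` hyperedges.
  have hlow := (tendsto_randomHypergraph_real_denseFamilies d ((d * (⌊B⌋₊ + 1)) ^ 2) δ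
    hδ').const_sub 1
  rw [sub_zero] at hlow
  refine tendsto_of_tendsto_of_tendsto_of_le_of_le hlow tendsto_const_nhds (fun n => ?_)
    fun n => measureReal_le_one
  have hunif : (randomHypergraph n d (hyperedgeProb d δ n)).real
      {H | H ⊆ {h : Finset (Fin n) | h.card = d}}ᶜ = 0 := by
    rw [measureReal_eq_zero_iff]
    exact setBernoulli_ae_subset
  -- Covering the whole space gives the lower bound by subadditivity alone, without measurability of
  -- the events.
  have hcover : (Set.univ : Set (Set (Finset (Fin n)))) ⊆
      ({H | ∀ C : Set (Finset (Fin n)),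
        IsTwoConnectedComponent (cliqueHypergraph d (projGraph H)) C → (C.ncard : ℝ) ≤ 1 + B} ∪
      denseFamilies n d ((d * (⌊B⌋₊ + 1)) ^ 2) δ) ∪
      {H | H ⊆ {h : Finset (Fin n) | h.card = d}}ᶜ := by
    intro H _
    by_cases h1 : H ⊆ {h : Finset (Fin n) | h.card = d}
    · left
      by_cases h2 : H ∈ denseFamilies n d ((d * (⌊B⌋₊ + 1)) ^ 2) δ
      · exact Or.inr h2
      · left
        intro C hC
        have hlt := ncard_component_le (N := ⌊B⌋₊ + 1) hd hδ
          (by rw [← hB]; exact_mod_cast Nat.lt_floor_add_one B) (fun e he => h1 he)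
          (fun F hF hFK => not_lt.1 fun h => h2 ⟨fun e he => h1 he, F, hF, hFK, h⟩) hC
        have : (C.ncard : ℝ) ≤ ⌊B⌋₊ := by exact_mod_cast Nat.le_of_lt_succ hlt
        linarith [Nat.floor_le hB0]
    · exact Or.inr h1
  have hone := (measureReal_mono (μ := randomHypergraph n d (hyperedgeProb d δ n)) hcover
    (measure_ne_top _ _)).trans ((measureReal_union_le _ _).trans
    (add_le_add_left (measureReal_union_le _ _) _))
  rw [probReal_univ, hunif, add_zero] at hone
  linarith
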